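/- **Setting.** Let $Z_1,Z_2,\dots$ be i.i.d. real random variables with distribution $P$. Assume that for some $\delta>0$ the distribution $P$ is absolutely continuous on $(-\delta,\delta)$ with a density $f_Z$ that is bounded on $(-\delta,\delta)$ and has one-sided limits $f_Z^{+}(0)=\lim_{z\downarrow0}f_Z(z)$ and $f_Z^{-}(0)=\lim_{z\uparrow0}f_Z(z)$ with $f_Z^{-}(0)+f_Z^{+}(0)>0$. (Outside $(-\delta,\delta)$ the distribution $P$ is arbitrary.) Fix an integer $q\ge1$. For each $n$ arrange $Z_1,\dots,Z_n$ as $Z_{g,(1)},\dots,Z_{g,(n)}$ with $|Z_{g,(1)}|\le\dots\le|Z_{g,(n)}|$, ties being broken in any way for which $S_n:=\sum_{j\le q}I\{Z_{g,(j)}\ge0\}$ is a random variable (when $n<q$, the sum runs over $j\le n$). Put $T_q(s)=\sqrt q\,\bigl|\tfrac sq-\tfrac12\bigr|$. Let $\Psi_q$ be the distribution function of the binomial distribution $\mathrm{Bi}(q,\tfrac12)$. For $\alpha\in(0,1)$ let $b_q(\alpha)$ be the unique $b\in\{0,1,\dots,\lfloor q/2\rfloor\}$ with $\Psi_q(b-1)\le\frac\alpha2<\Psi_q(b)$,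 let $c_q(\alpha)=\sqrt q\bigl(\frac12-\frac{b_q(\alpha)}q\bigr)$ and $$a_q(\alpha)=2^{q-1}\binom q{b_q(\alpha)}^{-1}\bigl[\alpha-2\Psi_q(b_q(\alpha)-1)\bigr].$$ The randomized test $\phi(s)$, i.e. the probability of rejection when $S_n=s$, equals $1$ if $T_q(s)>c_q(\alpha)$, equals $a_q(\alpha)$ if $T_q(s)=c_q(\alpha)$, and equals $0$ if $T_q(s)<c_q(\alpha)$. **Theorem.** Let $\alpha\in(0,1)$ and, if $q$ is even, let moreover $\alpha\le 1-2^{-q}\binom{q}{q/2}$ (this holds in particular whenever $\alpha\le\frac12$). (a) Under $H_0$: $f_Z^{+}(0)=f_Z^{-}(0)$, $$\lim_{n\to\infty}E[\phi(S_n)]=2\Psi_q(b_q(\alpha)-1)+\frac{a_q(\alpha)}{2^{q-1}}\binom q{b_q(\alpha)}=\alpha .$$ (b) Under $H_1$: $f_Z^{+}(0)\ne f_Z^{-}(0)$, the limit $\lim_{n\to\infty}E[\phi(S_n)]$ exists and is at least $\alpha$. -/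

import Mathlib

open MeasureTheory ProbabilityTheory Filter Topology

namespace SignTest

/-- `P` is absolutely continuous on `s` with density function `f` there; nothing is said about `P`
outside `s`. -/
structure HasDensityOn (P : Measure ℝ) (f : ℝ → ℝ) (s : Set ℝ) : Prop where
  aemeasurable : AEMeasurable f (volume.restrict s)
  nonneg : ∀ z ∈ s, 0 ≤ f z
  measure_eq : ∀ A : Set ℝ, MeasurableSet A → A ⊆ s → P A = ∫⁻ z in A, ENNReal.ofReal (f z)

/-- Local regularity of the distribution `P` of the running variable at the cut-off `0`: on
`(-δ, δ)` it has a bounded density `f`, with a right limit `fplus` and a left limit `fminus` at `0`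
which are not both zero. -/
structure LocalDensity (P : Measure ℝ) (δ : ℝ) (f : ℝ → ℝ) (fplus fminus : ℝ) : Prop where
  delta_pos : 0 < δ
  density : HasDensityOn P f (Set.Ioo (-δ) δ)
  bounded : ∃ M : ℝ, ∀ z ∈ Set.Ioo (-δ) δ, f z ≤ M
  right_limit : Tendsto f (𝓝[>] 0) (𝓝 fplus)
  left_limit : Tendsto f (𝓝[<] 0) (𝓝 fminus)
  sum_pos : 0 < fminus + fplus

/-- The permutation `σ` puts the sample `z` in `g`-order:
`g (z (σ 0)) ≤ g (z (σ 1)) ≤ ⋯ ≤ g (z (σ (n - 1)))`. Ties may be broken in any way. -/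
def IsGOrdering (g : ℝ → ℝ) {n : ℕ} (z : Fin n → ℝ) (σ : Equiv.Perm (Fin n)) : Prop :=
  Monotone fun j : Fin n => g (z (σ j))

/-- The `g`-order statistics induced by `σ` (with `0`-based index). -/
def gOrderStat {n : ℕ} (z : Fin n → ℝ) (σ : Equiv.Perm (Fin n)) (j : Fin n) : ℝ := z (σ j)

/-- `S_n`: the number of nonnegative values among the first `q` `g`-order statistics. -/
noncomputable def signCount (q : ℕ) {n : ℕ} (z : Fin n → ℝ) (σ : Equiv.Perm (Fin n)) : ℕ :=
  ∑ j : Fin n with j.val < q, if 0 ≤ gOrderStat z σ j then 1 else 0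

/-- `Ψ_q`: the cumulative distribution function of the binomial distribution `Bi(q, 1/2)`. -/
noncomputable def Psi (q : ℕ) (b : ℝ) : ℝ :=
  1 / 2 ^ q * ∑ x ∈ Finset.range (⌊b⌋₊ + 1),
      (q.choose x : ℝ) * (if 0 ≤ b ∧ b ≤ (q : ℝ) then 1 else 0)
    + (if (q : ℝ) < b then 1 else 0)

/-- The condition that determines `b_q(α)` in `{0, 1, …, ⌊q / 2⌋}`. -/
def IsCriticalCount (q : ℕ) (α : ℝ) (b : ℕ) : Prop :=
  b ≤ q / 2 ∧ Psi q ((b : ℝ) - 1) ≤ α / 2 ∧ α / 2 < Psi q (b : ℝ)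

/-- `b_q(α)`: the element of `{0, 1, …, ⌊q / 2⌋}` with `Ψ_q(b - 1) ≤ α / 2 < Ψ_q(b)`; it exists and
is unique for `α ∈ (0, 1)`, see `existsUnique_isCriticalCount`. -/
noncomputable def bq (q : ℕ) (α : ℝ) : ℕ := sInf {b : ℕ | IsCriticalCount q α b}

/-- The test statistic `T_q(s) = √q |s / q - 1 / 2|`. -/
noncomputable def testStat (q s : ℕ) : ℝ := √(q : ℝ) * |1 / (q : ℝ) * (s : ℝ) - 1 / 2|

/-- The critical value `c_q(α) = √q (1 / 2 - b_q(α) / q)`. -/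
noncomputable def critVal (q : ℕ) (α : ℝ) : ℝ := √(q : ℝ) * (1 / 2 - (bq q α : ℝ) / (q : ℝ))

/-- The randomization probability `a_q(α)`. -/
noncomputable def aq (q : ℕ) (α : ℝ) : ℝ :=
  2 ^ (q - 1) * (q.choose (bq q α) : ℝ)⁻¹ * (α - 2 * Psi q ((bq q α : ℝ) - 1))

/-- The randomized approximate sign test: `phi q α s` is the probability with which the test
rejects when `S_n = s`. -/
noncomputable def phi (q : ℕ) (α : ℝ) (s : ℕ) : ℝ :=
  if critVal q α < testStat q s then 1
  else if testStat q s = critVal q α then aq q α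
  else 0

/-! Well-definedness of `b_q(α)`. -/

lemma Psi_natCast {q b : ℕ} (hb : b ≤ q) :
    Psi q (b : ℝ) = 1 / 2 ^ q * ∑ x ∈ Finset.range (b + 1), (q.choose x : ℝ) := by
  have h1 : (b : ℝ) ≤ q := by exact_mod_cast hb
  simp [Psi, h1, not_lt.mpr h1]

lemma Psi_pred_zero (q : ℕ) : Psi q (((0 : ℕ) : ℝ) - 1) = 0 := by
  have h1 : ¬ (q : ℝ) < -1 := by
    have : (0 : ℝ) ≤ q := q.cast_nonneg
    linarith
  have h2 : ¬ (0 : ℝ) ≤ -1 := by norm_num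
  simp [Psi, h1, h2]

lemma Psi_mono {q b c : ℕ} (hbc : b ≤ c) (hc : c ≤ q) : Psi q (b : ℝ) ≤ Psi q (c : ℝ) := by
  rw [Psi_natCast (hbc.trans hc), Psi_natCast hc]
  refine mul_le_mul_of_nonneg_left ?_ (by positivity)
  refine Finset.sum_le_sum_of_subset_of_nonneg ?_ (fun _ _ _ => by positivity)
  intro x hx
  simp only [Finset.mem_range] at hx ⊢
  omega

lemma half_le_Psi_half (q : ℕ) : 1 / 2 ≤ Psi q ((q / 2 : ℕ) : ℝ) := by
  rw [Psi_natCast (Nat.div_le_self q 2)]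
  have h2 : (∑ x ∈ Finset.range (q + 1), (q.choose x : ℝ)) = 2 ^ q := by
    exact_mod_cast Nat.sum_range_choose q
  have h3 := Finset.sum_range_add_sum_Ico (fun x => (q.choose x : ℝ))
    (show q / 2 + 1 ≤ q + 1 by omega)
  have h4 : ∑ x ∈ Finset.Ico (q / 2 + 1) (q + 1), (q.choose x : ℝ)
      ≤ ∑ x ∈ Finset.range (q / 2 + 1), (q.choose x : ℝ) := by
    have h5 : ∑ x ∈ Finset.Ico (q / 2 + 1) (q + 1), (q.choose x : ℝ)
        = ∑ x ∈ (Finset.Ico (q / 2 + 1) (q + 1)).image (fun x => q - x), (q.choose x : ℝ) := by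
      rw [Finset.sum_image]
      · refine Finset.sum_congr rfl fun x hx => ?_
        rw [Finset.mem_Ico] at hx
        rw [Nat.choose_symm (by omega)]
      · intro x hx y hy hxy
        simp only [Finset.coe_Ico, Set.mem_Ico] at hx hy hxy
        omega
    rw [h5]
    refine Finset.sum_le_sum_of_subset_of_nonneg ?_ (fun _ _ _ => by positivity)
    intro x hx
    simp only [Finset.mem_image, Finset.mem_Ico, Finset.mem_range] at hx ⊢
    omega
  have h6 : (0 : ℝ) < 2 ^ q := by positivity
  rw [one_div_mul_eq_div, div_le_div_iff₀ (by norm_num) h6]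
  linarith

theorem existsUnique_isCriticalCount (q : ℕ) {α : ℝ} (h0 : 0 < α) (h1 : α < 1) :
    ∃! b : ℕ, IsCriticalCount q α b := by
  classical
  have hex : ∃ b : ℕ, α / 2 < Psi q (b : ℝ) :=
    ⟨q / 2, lt_of_lt_of_le (by linarith) (half_le_Psi_half q)⟩
  have hle : Nat.find hex ≤ q / 2 :=
    Nat.find_min' hex (lt_of_lt_of_le (by linarith) (half_le_Psi_half q))
  refine ⟨Nat.find hex, ⟨hle, ?_, Nat.find_spec hex⟩, ?_⟩
  · rcases Nat.eq_zero_or_pos (Nat.find hex) with h | h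
    · rw [h, Psi_pred_zero]
      linarith
    · have := Nat.find_min hex (Nat.sub_lt h one_pos)
      rwa [not_lt, Nat.cast_pred h] at this
  · rintro c ⟨hc1, hc2, hc3⟩
    refine le_antisymm ?_ (Nat.find_min' hex hc3)
    by_contra! hlt
    have hc0 : 1 ≤ c := by omega
    have h2 : Psi q ((Nat.find hex : ℕ) : ℝ) ≤ Psi q ((c - 1 : ℕ) : ℝ) :=
      Psi_mono (by omega) (by omega)
    rw [Nat.cast_sub hc0, Nat.cast_one] at h2
    have h3 := Nat.find_spec hex
    linarith

theorem isCriticalCount_bq (q : ℕ) {α : ℝ} (h0 : 0 < α) (h1 : α < 1) :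
    IsCriticalCount q α (bq q α) :=
  Nat.sInf_mem (existsUnique_isCriticalCount q h0 h1).exists

end SignTest

open scoped ENNReal NNReal

namespace SignTest

/-! ### The test function in terms of counts -/

/-! Put p = f⁺/(f⁻ + f⁺). The core fact is that S_n converges in law to Bi(q, p)
(`tendsto_integral_comp_signCount`); both claims are then statements about the binomial law. For p =
1/2 the test has level α by the choice of b and a (`sum_phi_mul_choose`). For any p, it is a
likelihood ratio test of p = 1/2 against the even mixture of p and 1 - p, hence unbiased
(`le_sum_phi_mul_binomialWeight`).

For the convergence, choose r so small that, given |Z| = x < r, the sign of Z is nonnegative with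
probability at most p + η and negative with probability at most 1 - p + η. Which indices are nearest
to 0 depends only on absolute values, so this domination passes coordinatewise to product measures:
a prescribed sign pattern on a set J costs a factor (p + η)^s (1 - p + η)^(q - s) relative to the
event that J is nearest (`measure_nearestSignSet_le`). The latter events are almost disjoint, so
summing over J gives nearly the binomial weight as an upper bound (`measure_nearestCountSet_le`).
With probability tending to 1 at least q observations fall in (-r, r)
(`tendsto_measure_hitCount_lt`). Upper bounds suffice, because on both sides the masses sum to 1
(`tendsto_of_forall_le_add`). -/

lemma testStat_eq {q : ℕ} (hq : 1 ≤ q) (s : ℕ) :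
    testStat q s = √(q : ℝ) / (2 * q) * |2 * (s : ℝ) - q| := by
  have hq' : (0 : ℝ) < q := by exact_mod_cast hq
  have h : 1 / (q : ℝ) * (s : ℝ) - 1 / 2 = 1 / (2 * q) * (2 * s - q) := by field_simp
  rw [testStat, h, abs_mul, abs_of_pos (by positivity : (0 : ℝ) < 1 / (2 * q))]
  ring

lemma critVal_eq {q : ℕ} (hq : 1 ≤ q) (α : ℝ) :
    critVal q α = √(q : ℝ) / (2 * q) * ((q : ℝ) - 2 * bq q α) := by
  have hq' : (0 : ℝ) < q := by exact_mod_cast hq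
  rw [critVal]
  field_simp

/-- Both sides carry the positive factor √q / (2q); cancelling it leaves q - 2b < |2s - q|, a
comparison of integers. -/
lemma critVal_lt_testStat_iff {q : ℕ} (hq : 1 ≤ q) (α : ℝ) (s : ℕ) :
    critVal q α < testStat q s ↔ s < bq q α ∨ q < s + bq q α := by
  have hq' : (0 : ℝ) < q := by exact_mod_cast hq
  have hk : 0 < √(q : ℝ) / (2 * q) := by positivity
  rw [testStat_eq hq, critVal_eq hq, mul_lt_mul_iff_of_pos_left hk, lt_abs, or_comm]
  refine or_congr ?_ ?_
  · rw [← Nat.cast_lt (α := ℝ)]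
    constructor <;> intro h <;> linarith
  · rw [← Nat.cast_lt (α := ℝ)]
    push_cast
    constructor <;> intro h <;> linarith

lemma testStat_eq_critVal_iff {q : ℕ} (hq : 1 ≤ q) {α : ℝ} (hb : 2 * bq q α ≤ q) (s : ℕ) :
    testStat q s = critVal q α ↔ s = bq q α ∨ s + bq q α = q := by
  have hq' : (0 : ℝ) < q := by exact_mod_cast hq
  have hk : √(q : ℝ) / (2 * q) ≠ 0 := by positivity
  have hb' : (0 : ℝ) ≤ (q : ℝ) - 2 * bq q α := by
    have : (2 * bq q α : ℝ) ≤ q := by exact_mod_cast hb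
    linarith
  rw [testStat_eq hq, critVal_eq hq, mul_right_inj' hk, abs_eq hb', or_comm]
  refine or_congr ?_ ?_
  · rw [← Nat.cast_inj (R := ℝ)]
    constructor <;> intro h <;> linarith
  · rw [← Nat.cast_inj (R := ℝ)]
    push_cast
    constructor <;> intro h <;> linarith

lemma phi_eq {q : ℕ} (hq : 1 ≤ q) {α : ℝ} (hb : 2 * bq q α ≤ q) (s : ℕ) :
    phi q α s = if s < bq q α ∨ q < s + bq q α then 1
      else if s = bq q α ∨ s + bq q α = q then aq q α else 0 := by
  simp only [phi, critVal_lt_testStat_iff hq, testStat_eq_critVal_iff hq hb]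

lemma phi_symm {q : ℕ} (hq : 1 ≤ q) {α : ℝ} (hb : 2 * bq q α ≤ q) {s : ℕ} (hs : s ≤ q) :
    phi q α (q - s) = phi q α s := by
  rw [phi_eq hq hb, phi_eq hq hb]
  congr 1
  · apply propext; omega
  · congr 1
    apply propext; omega

/-! ### The level of the test -/

lemma Psi_sub_one {q b : ℕ} (hb : b ≤ q) :
    Psi q ((b : ℝ) - 1) = 1 / 2 ^ q * ∑ x ∈ Finset.range b, (q.choose x : ℝ) := by
  rcases Nat.eq_zero_or_pos b with rfl | h
  · rw [Psi_pred_zero]; simp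
  · rw [← Nat.cast_pred h, Psi_natCast (by omega), Nat.sub_add_cancel h]

/-- The randomization probability is defined as the solution of this equation. -/
lemma two_mul_Psi_add {q : ℕ} {α : ℝ} (hb : bq q α ≤ q) :
    2 * Psi q ((bq q α : ℝ) - 1) + aq q α / 2 ^ (q - 1) * (q.choose (bq q α) : ℝ) = α := by
  have h : (q.choose (bq q α) : ℝ) ≠ 0 := by exact_mod_cast (Nat.choose_pos hb).ne'
  rw [aq]
  field_simp
  ring

lemma sum_lt_mul_choose {q b : ℕ} (hb : b ≤ q) :
    ∑ s ∈ Finset.range (q + 1), (if s < b then (1 : ℝ) else 0) * q.choose s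
      = ∑ s ∈ Finset.range b, (q.choose s : ℝ) := by
  simp only [ite_mul, one_mul, zero_mul]
  rw [← Finset.sum_filter]
  refine Finset.sum_congr ?_ fun _ _ => rfl
  ext x
  simp only [Finset.mem_filter, Finset.mem_range]
  omega

lemma sum_reflect_mul_choose (q : ℕ) (g : ℕ → ℝ) :
    ∑ s ∈ Finset.range (q + 1), g (q - s) * q.choose s
      = ∑ s ∈ Finset.range (q + 1), g s * q.choose s := by
  rw [← Finset.sum_range_reflect (fun s => g s * (q.choose s : ℝ))]
  refine Finset.sum_congr rfl fun s hs => ?_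
  rw [Finset.mem_range] at hs
  rw [Nat.add_sub_cancel, Nat.choose_symm (by omega)]

lemma two_mul_sum_range_half {q b : ℕ} (hb : 2 * b = q) :
    2 * ∑ s ∈ Finset.range b, (q.choose s : ℝ) + q.choose b = 2 ^ q := by
  have h1 : (∑ x ∈ Finset.range (q + 1), (q.choose x : ℝ)) = 2 ^ q := by
    exact_mod_cast Nat.sum_range_choose q
  have h2 := sum_lt_mul_choose (q := q) (b := b) (by omega)
  have h3 := sum_reflect_mul_choose q (fun s => if s < b then (1 : ℝ) else 0)
  have h4 : ∑ s ∈ Finset.range (q + 1), (if s = b then (1 : ℝ) else 0) * q.choose s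
      = q.choose b := by
    simp only [ite_mul, one_mul, zero_mul]
    rw [Finset.sum_ite_eq', if_pos (Finset.mem_range.2 (by omega))]
  rw [h2] at h3
  rw [two_mul, ← h1, ← h4]
  nth_rw 1 [← h3]
  rw [← h2, ← Finset.sum_add_distrib, ← Finset.sum_add_distrib]
  refine Finset.sum_congr rfl fun s hs => ?_
  rw [Finset.mem_range] at hs
  split_ifs <;> first | omega | ring

lemma sum_phi_mul_choose {q : ℕ} (hq : 1 ≤ q) {α : ℝ} (hα0 : 0 < α) (hα1 : α < 1)
    (hαq : Even q → α ≤ 1 - (q.choose (q / 2) : ℝ) / 2 ^ q) :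
    ∑ s ∈ Finset.range (q + 1), phi q α s * q.choose s = α * 2 ^ q := by
  obtain ⟨hb, hlow, -⟩ := isCriticalCount_bq q hα0 hα1
  have hb2 : 2 * bq q α ≤ q := by omega
  -- If b = q/2, the boundary points b and q - b coincide and the level formula would count them
  -- twice. The bound on α then meets Ψ(b - 1) ≤ α/2 with equality, so no randomization is left.
  have ha : 2 * bq q α = q → aq q α = 0 := by
    intro h
    have h1 := hαq ⟨bq q α, by omega⟩
    have h2 := two_mul_sum_range_half h
    have h3 : q / 2 = bq q α := by omega
    rw [h3] at h1
    have h4 : α - 2 * Psi q ((bq q α : ℝ) - 1) = 0 := by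
      have h5 : 2 * Psi q ((bq q α : ℝ) - 1) = 1 - (q.choose (bq q α) : ℝ) / 2 ^ q := by
        rw [Psi_sub_one (by omega)]
        field_simp
        linarith
      linarith
    rw [aq, h4, mul_zero]
  set b := bq q α with hbdef
  have hphi : ∀ s ∈ Finset.range (q + 1), phi q α s * (q.choose s : ℝ)
      = (if s < b then (1 : ℝ) else 0) * q.choose s
        + (if q - s < b then (1 : ℝ) else 0) * q.choose s
        + aq q α * ((if s = b then (1 : ℝ) else 0) * q.choose s)
        + aq q α * ((if q - s = b then (1 : ℝ) else 0) * q.choose s) := by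
    intro s hs
    rw [Finset.mem_range] at hs
    rw [phi_eq hq hb2, ← hbdef]
    rcases Nat.eq_or_lt_of_le hb2 with h | h
    · rw [ha h]
      split_ifs <;> first | omega | ring
    · split_ifs <;> first | omega | ring
  rw [Finset.sum_congr rfl hphi, Finset.sum_add_distrib, Finset.sum_add_distrib,
    Finset.sum_add_distrib, ← Finset.mul_sum, ← Finset.mul_sum,
    sum_reflect_mul_choose q (fun s => if s < b then (1 : ℝ) else 0),
    sum_reflect_mul_choose q (fun s => if s = b then (1 : ℝ) else 0),
    sum_lt_mul_choose (by omega)]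
  have h4 : ∑ s ∈ Finset.range (q + 1), (if s = b then (1 : ℝ) else 0) * q.choose s
      = q.choose b := by
    simp only [ite_mul, one_mul, zero_mul]
    rw [Finset.sum_ite_eq', if_pos (Finset.mem_range.2 (by omega))]
  have h5 := two_mul_Psi_add (q := q) (α := α) (by omega)
  have h6 : (2 : ℝ) ^ q = 2 * 2 ^ (q - 1) := by
    rw [← pow_succ', Nat.sub_add_cancel hq]
  rw [h4, h6]
  rw [← hbdef, Psi_sub_one (by omega), h6] at h5
  field_simp at h5
  linarith

/-! ### The asymptotic power of the test -/

/-- The probability that a `Bi(q, p)`-distributed variable equals `s`. -/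
noncomputable def binomialWeight (q : ℕ) (p : ℝ) (s : ℕ) : ℝ :=
  q.choose s * p ^ s * (1 - p) ^ (q - s)

lemma sum_binomialWeight (q : ℕ) (p : ℝ) :
    ∑ s ∈ Finset.range (q + 1), binomialWeight q p s = 1 := by
  have h := add_pow p (1 - p) q
  rw [add_sub_cancel, one_pow] at h
  rw [h]
  exact Finset.sum_congr rfl fun s _ => by rw [binomialWeight]; ring

lemma sum_phi_mul_binomialWeight_half {q : ℕ} (hq : 1 ≤ q) {α : ℝ} (hα0 : 0 < α) (hα1 : α < 1)
    (hαq : Even q → α ≤ 1 - (q.choose (q / 2) : ℝ) / 2 ^ q) :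
    ∑ s ∈ Finset.range (q + 1), phi q α s * binomialWeight q (1 / 2) s = α := by
  have h : ∀ s ∈ Finset.range (q + 1), phi q α s * binomialWeight q (1 / 2) s
      = (1 / 2) ^ q * (phi q α s * q.choose s) := by
    intro s hs
    rw [Finset.mem_range] at hs
    have h1 : ((1 : ℝ) / 2) ^ q = (1 / 2) ^ s * (1 / 2) ^ (q - s) := by
      rw [← pow_add]; congr 1; omega
    rw [binomialWeight, h1]
    norm_num
    ring
  rw [Finset.sum_congr rfl h, ← Finset.mul_sum, sum_phi_mul_choose hq hα0 hα1 hαq]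
  rw [one_div, inv_pow]
  field_simp

/-- With d = t - s and e = q - s - t the difference of the two sides is x^s y^s (x^d - y^d)(x^e -
y^e), whose last two factors have the same sign. -/
lemma mul_add_pow_le {x y : ℝ} (hx : 0 ≤ x) (hy : 0 ≤ y) {q s t : ℕ} (hst : s ≤ t)
    (htq : s + t ≤ q) :
    x ^ t * y ^ (q - t) + x ^ (q - t) * y ^ t ≤ x ^ s * y ^ (q - s) + x ^ (q - s) * y ^ s := by
  obtain ⟨d, rfl⟩ := Nat.exists_eq_add_of_le hst
  obtain ⟨e, rfl⟩ : ∃ e, q = s + (s + d) + e := Nat.exists_eq_add_of_le htq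
  have h1 : s + (s + d) + e - (s + d) = s + e := by omega
  have h2 : s + (s + d) + e - s = s + d + e := by omega
  rw [h1, h2]
  have key : 0 ≤ (x ^ d - y ^ d) * (x ^ e - y ^ e) := by
    rcases le_total x y with h | h
    · exact mul_nonneg_of_nonpos_of_nonpos (sub_nonpos.2 (pow_le_pow_left₀ hx h d))
        (sub_nonpos.2 (pow_le_pow_left₀ hx h e))
    · exact mul_nonneg (sub_nonneg.2 (pow_le_pow_left₀ hy h d))
        (sub_nonneg.2 (pow_le_pow_left₀ hy h e))
  have h3 : 0 ≤ x ^ s * y ^ s * ((x ^ d - y ^ d) * (x ^ e - y ^ e)) := by positivity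
  simp only [pow_add]
  nlinarith [h3]

/-- A Neyman–Pearson argument: the test is unbiased against all binomial alternatives. -/
lemma le_sum_phi_mul_binomialWeight {q : ℕ} (hq : 1 ≤ q) {α : ℝ} (hα0 : 0 < α) (hα1 : α < 1)
    (hαq : Even q → α ≤ 1 - (q.choose (q / 2) : ℝ) / 2 ^ q) {p : ℝ} (hp0 : 0 ≤ p) (hp1 : p ≤ 1) :
    α ≤ ∑ s ∈ Finset.range (q + 1), phi q α s * binomialWeight q p s := by
  have hb2 : 2 * bq q α ≤ q := by
    have := (isCriticalCount_bq q hα0 hα1).1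
    omega
  have hr : 0 ≤ 1 - p := by linarith
  -- The test is symmetric under s ↦ q - s, so the alternative may be symmetrized; the resulting
  -- likelihood `w` grows with the distance of s from q/2.
  set w : ℕ → ℝ := fun s => p ^ s * (1 - p) ^ (q - s) + p ^ (q - s) * (1 - p) ^ s with hw
  have hwsymm : ∀ s ≤ q, w (q - s) = w s := by
    intro s hs
    simp only [hw, Nat.sub_sub_self hs]
    ring
  have hwmono : ∀ s t, s ≤ t → s + t ≤ q → w t ≤ w s := fun s t h1 h2 =>
    mul_add_pow_le hp0 hr h1 h2
  -- On the randomization points `w` equals its threshold value, so the size of `aq` plays no role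
  -- here.
  have hterm : ∀ s ∈ Finset.range (q + 1),
      0 ≤ (phi q α s - α) * (w s - w (bq q α)) * q.choose s := by
    intro s hs
    have hs' : s ≤ q := by rw [Finset.mem_range] at hs; omega
    refine mul_nonneg ?_ (Nat.cast_nonneg _)
    rw [phi_eq hq hb2]
    split_ifs with h1 h2
    · refine mul_nonneg (by linarith) (sub_nonneg.2 ?_)
      rcases h1 with h1 | h1
      · exact hwmono _ _ h1.le (by omega)
      · rw [← hwsymm s hs']
        exact hwmono _ _ (by omega) (by omega)
    · have : w s = w (bq q α) := by
        rcases h2 with h2 | h2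
        · rw [h2]
        · rw [← hwsymm s hs']
          congr 1; omega
      rw [this, sub_self, mul_zero]
    · refine mul_nonneg_of_nonpos_of_nonpos (by linarith) (sub_nonpos.2 ?_)
      exact hwmono _ _ (by omega) (by omega)
  have hsum := Finset.sum_nonneg hterm
  have hchoose : (∑ x ∈ Finset.range (q + 1), (q.choose x : ℝ)) = 2 ^ q := by
    exact_mod_cast Nat.sum_range_choose q
  have hlevel := sum_phi_mul_choose hq hα0 hα1 hαq
  have hw_sum : ∀ g : ℕ → ℝ, (∀ s ≤ q, g (q - s) = g s) →
      ∑ s ∈ Finset.range (q + 1), g s * w s * q.choose s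
        = 2 * ∑ s ∈ Finset.range (q + 1), g s * binomialWeight q p s := by
    intro g hg
    have h1 := sum_reflect_mul_choose q (fun s => g s * (p ^ s * (1 - p) ^ (q - s)))
    have h2 : ∀ s ∈ Finset.range (q + 1), g s * w s * (q.choose s : ℝ)
        = g s * (p ^ s * (1 - p) ^ (q - s)) * q.choose s
          + g (q - s) * (p ^ (q - s) * (1 - p) ^ (q - (q - s))) * q.choose s := by
      intro s hs
      have hs' : s ≤ q := by rw [Finset.mem_range] at hs; omega
      rw [hg s hs', Nat.sub_sub_self hs']
      simp only [hw]
      ring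
    rw [Finset.sum_congr rfl h2, Finset.sum_add_distrib, h1, ← two_mul]
    congr 1
    exact Finset.sum_congr rfl fun s _ => by rw [binomialWeight]; ring
  have h1 := hw_sum (phi q α) fun s hs => phi_symm hq hb2 hs
  have h2 := hw_sum (fun _ => 1) fun _ _ => rfl
  simp only [one_mul] at h2
  rw [sum_binomialWeight] at h2
  -- The threshold terms cancel, since `phi` and the constant α have the same sum against the
  -- binomial coefficients.
  have h3 : ∑ s ∈ Finset.range (q + 1), (phi q α s - α) * (w s - w (bq q α)) * q.choose s
      = ∑ s ∈ Finset.range (q + 1), phi q α s * w s * q.choose s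
        - α * ∑ s ∈ Finset.range (q + 1), w s * q.choose s
        - w (bq q α) * ∑ s ∈ Finset.range (q + 1), phi q α s * q.choose s
        + α * w (bq q α) * ∑ s ∈ Finset.range (q + 1), (q.choose s : ℝ) := by
    simp only [Finset.mul_sum, ← Finset.sum_sub_distrib, ← Finset.sum_add_distrib]
    exact Finset.sum_congr rfl fun s _ => by ring
  rw [h3, h1, h2, hlevel, hchoose] at hsum
  linarith

/-! ### Convergence from upper bounds -/

/-- Equal total mass turns upper bounds into lower ones: the slacks in the upper bounds are
nonnegative with a small sum, so each of them is small. -/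
lemma tendsto_of_forall_le_add {ι : Type*} {I : Finset ι} {a : ℕ → ι → ℝ} {b : ι → ℝ}
    (ha : ∀ n, ∑ i ∈ I, a n i = 1) (hb : ∑ i ∈ I, b i = 1)
    (h : ∀ i ∈ I, ∀ ε > 0, ∀ᶠ n in atTop, a n i ≤ b i + ε) {i : ι} (hi : i ∈ I) :
    Tendsto (fun n => a n i) atTop (𝓝 (b i)) := by
  rw [Metric.tendsto_atTop']
  intro ε hε
  have hcard : (0 : ℝ) < I.card := by exact_mod_cast Finset.card_pos.2 ⟨i, hi⟩
  have hev : ∀ᶠ n in atTop, ∀ j ∈ I, a n j ≤ b j + ε / (2 * I.card) :=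
    (Filter.eventually_all_finset I).2 fun j hj => h j hj _ (by positivity)
  obtain ⟨N, hN⟩ := eventually_atTop.1 hev
  refine ⟨N, fun n hn => ?_⟩
  have h1 := hN n hn.le
  have h2 : ∑ j ∈ I, (b j + ε / (2 * I.card) - a n j) = ε / 2 := by
    rw [Finset.sum_sub_distrib, Finset.sum_add_distrib, ha, hb, Finset.sum_const, nsmul_eq_mul]
    field_simp
    ring
  have h3 : b i + ε / (2 * I.card) - a n i ≤ ε / 2 := by
    rw [← h2]
    exact Finset.single_le_sum (f := fun j => b j + ε / (2 * I.card) - a n j)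
      (fun j hj => by linarith [h1 j hj]) hi
  have h4 := h1 i hi
  have h5 : ε / (2 * I.card) ≤ ε / 2 := by
    apply div_le_div_of_nonneg_left hε.le (by norm_num)
    have : (1 : ℝ) ≤ I.card := by exact_mod_cast Finset.card_pos.2 ⟨i, hi⟩
    linarith
  have h6 : 0 < ε / (2 * I.card) := by positivity
  rw [Real.dist_eq, abs_lt]
  constructor <;> linarith

/-! ### Comparison of product measures -/

lemma measure_pi_le_prod_mul {ι : Type*} [Fintype ι] {ν ρ : ι → Measure ℝ}
    [∀ i, IsFiniteMeasure (ν i)] [∀ i, IsFiniteMeasure (ρ i)] {c : ι → ℝ≥0}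
    (h : ∀ i, ν i ≤ c i • ρ i) (A : Set (ι → ℝ)) :
    Measure.pi ν A ≤ (∏ i, (c i : ℝ≥0∞)) * Measure.pi ρ A := by
  have h1 : Measure.pi (fun i => c i • ρ i) = (∏ i, (c i : ℝ≥0∞)) • Measure.pi ρ := by
    refine Measure.pi_eq fun s hs => ?_
    rw [Measure.smul_apply, Measure.pi_pi, smul_eq_mul, ← Finset.prod_mul_distrib]
    rfl
  have h2 : Measure.pi ν ≤ Measure.pi (fun i => c i • ρ i) := by
    refine Measure.le_iff.2 fun s hs => ?_
    conv_rhs => rw [Measure.pi, toMeasure_apply _ _ hs]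
    -- The product outer measure is the largest one bounded by the products on boxes, so comparing
    -- on boxes is enough.
    have h3 : (Measure.pi ν).toOuterMeasure
        ≤ OuterMeasure.pi fun i => (c i • ρ i).toOuterMeasure := by
      refine OuterMeasure.le_pi.2 fun t _ => ?_
      refine (Measure.pi_pi ν t).le.trans ?_
      exact Finset.prod_le_prod' fun i _ => h i (t i)
    exact h3 s
  have h4 := h2 A
  rwa [h1, Measure.smul_apply, smul_eq_mul] at h4

/-! ### The events that a given set of indices is nearest to the cut-off -/

/-- The observations with index in `J` have absolute value less than `r`, and no other observation
has a smaller absolute value than one of them. -/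
def nearestSet (r : ℝ) {n : ℕ} (J : Finset (Fin n)) : Set (Fin n → ℝ) :=
  {z | (∀ i ∈ J, z i ∈ Set.Ioo (-r) r) ∧ ∀ i ∈ J, ∀ j ∉ J, |z i| ≤ |z j|}

/-- The part of `nearestSet r J` where exactly the observations with index in `K` are
nonnegative among those with index in `J`. -/
def nearestSignSet (r : ℝ) {n : ℕ} (J K : Finset (Fin n)) : Set (Fin n → ℝ) :=
  {z | z ∈ nearestSet r J ∧ ∀ i ∈ J, 0 ≤ z i ↔ i ∈ K}

lemma measurableSet_forall_abs_le {n : ℕ} (J : Finset (Fin n)) :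
    MeasurableSet {y : Fin n → ℝ | ∀ i ∈ J, ∀ j ∉ J, y i ≤ y j} := by
  simp only [Set.ofPred_forall]
  refine MeasurableSet.iInter fun i => MeasurableSet.iInter fun _ => MeasurableSet.iInter fun j =>
    MeasurableSet.iInter fun _ => ?_
  exact measurableSet_le (measurable_pi_apply i) (measurable_pi_apply j)

/-- Encodes an event about absolute values, together with coordinatewise constraints, as one product
measure, ready for `measure_pi_le_prod_mul`. -/
lemma measure_pi_restrict_map_abs {n : ℕ} (P : Measure ℝ) [IsProbabilityMeasure P]
    (s : Fin n → Set ℝ) {D : Set (Fin n → ℝ)}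
    (hD : MeasurableSet D) :
    Measure.pi (fun i => (P.restrict (s i)).map (fun x : ℝ => |x|)) D
      = Measure.pi (fun _ => P) {z | (fun i => |z i|) ∈ D ∧ ∀ i, z i ∈ s i} := by
  have habs : Measurable fun x : ℝ => |x| := measurable_abs
  have hmap : Measurable fun (z : Fin n → ℝ) i => |z i| :=
    measurable_pi_lambda _ fun i => habs.comp (measurable_pi_apply i)
  rw [← Measure.pi_map_pi (fun i => habs.aemeasurable), Measure.map_apply hmap hD,
    ← Measure.restrict_pi_pi, Measure.restrict_apply (hmap hD)]
  congr 1
  ext z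
  simp

/-- Given the absolute values, the signs of the observations close to the cut-off behave almost
like independent coin flips. -/
lemma measure_nearestSignSet_le {P : Measure ℝ} [IsProbabilityMeasure P] {r : ℝ} {c d : ℝ≥0}
    (hc : (P.restrict (Set.Ico 0 r)).map (fun x : ℝ => |x|)
      ≤ c • (P.restrict (Set.Ioo (-r) r)).map fun x : ℝ => |x|)
    (hd : (P.restrict (Set.Ioo (-r) 0)).map (fun x : ℝ => |x|)
      ≤ d • (P.restrict (Set.Ioo (-r) r)).map fun x : ℝ => |x|)
    {n : ℕ} {J K : Finset (Fin n)} (hKJ : K ⊆ J) :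
    Measure.pi (fun _ => P) (nearestSignSet r J K)
      ≤ (c : ℝ≥0∞) ^ K.card * (d : ℝ≥0∞) ^ (J.card - K.card)
        * Measure.pi (fun _ => P) (nearestSet r J) := by
  set D := {y : Fin n → ℝ | ∀ i ∈ J, ∀ j ∉ J, y i ≤ y j}
  have hD : MeasurableSet D := measurableSet_forall_abs_le J
  set s : Fin n → Set ℝ := fun i =>
    if i ∈ K then Set.Ico 0 r else if i ∈ J then Set.Ioo (-r) 0 else Set.univ with hs
  set t : Fin n → Set ℝ := fun i => if i ∈ J then Set.Ioo (-r) r else Set.univ with ht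
  -- Coordinates outside `J` are unconstrained on both sides, hence the factor 1.
  set e : Fin n → ℝ≥0 := fun i => if i ∈ K then c else if i ∈ J then d else 1 with he
  have hsm : ∀ i, MeasurableSet (s i) := fun i => by
    simp only [hs]
    split_ifs
    exacts [measurableSet_Ico, measurableSet_Ioo, MeasurableSet.univ]
  have htm : ∀ i, MeasurableSet (t i) := fun i => by
    simp only [ht]
    split_ifs
    exacts [measurableSet_Ioo, MeasurableSet.univ]
  have hle : ∀ i, (P.restrict (s i)).map (fun x : ℝ => |x|)
      ≤ e i • (P.restrict (t i)).map fun x : ℝ => |x| := by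
    intro i
    simp only [hs, ht, he]
    by_cases hK : i ∈ K
    · simpa [hK, hKJ hK] using hc
    · by_cases hJ : i ∈ J
      · simpa [hK, hJ] using hd
      · simp [hK, hJ]
  have key := measure_pi_le_prod_mul hle D
  rw [measure_pi_restrict_map_abs P s hD, measure_pi_restrict_map_abs P t hD] at key
  have hprod : (∏ i, (e i : ℝ≥0∞)) = (c : ℝ≥0∞) ^ K.card * (d : ℝ≥0∞) ^ (J.card - K.card) := by
    have h1 : ∀ i, (e i : ℝ≥0∞)
        = (if i ∈ K then (c : ℝ≥0∞) else 1) * (if i ∈ J \ K then (d : ℝ≥0∞) else 1) := by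
      intro i
      simp only [he, Finset.mem_sdiff]
      by_cases hK : i ∈ K
      · simp [hK]
      · by_cases hJ : i ∈ J <;> simp [hK, hJ]
    simp only [h1]
    rw [Finset.prod_mul_distrib, Finset.prod_ite_mem, Finset.prod_ite_mem, Finset.univ_inter,
      Finset.univ_inter, Finset.prod_const, Finset.prod_const, Finset.card_sdiff_of_subset hKJ]
  rw [hprod] at key
  refine le_trans (measure_mono ?_) (key.trans (mul_le_mul_right (measure_mono ?_) _))
  · rintro z ⟨⟨hz1, hz2⟩, hz3⟩
    refine ⟨hz2, fun i => ?_⟩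
    simp only [hs]
    split_ifs with hK hJ
    · exact ⟨(hz3 i (hKJ hK)).2 hK, (hz1 i (hKJ hK)).2⟩
    · exact ⟨(hz1 i hJ).1, not_le.1 fun h => hK ((hz3 i hJ).1 h)⟩
    · trivial
  · rintro z ⟨hz1, hz2⟩
    refine ⟨fun i hi => ?_, hz1⟩
    have := hz2 i
    simpa [ht, hi] using this

lemma measurableSet_nearestSet (r : ℝ) {n : ℕ} (J : Finset (Fin n)) :
    MeasurableSet (nearestSet r J) := by
  have habs : Measurable fun x : ℝ => |x| := measurable_abs
  have h1 : MeasurableSet {z : Fin n → ℝ | ∀ i ∈ J, z i ∈ Set.Ioo (-r) r} := by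
    simp only [Set.ofPred_forall]
    exact MeasurableSet.iInter fun i => MeasurableSet.iInter fun _ =>
      measurable_pi_apply i measurableSet_Ioo
  have hmap : Measurable fun (z : Fin n → ℝ) i => |z i| :=
    measurable_pi_lambda _ fun i => habs.comp (measurable_pi_apply i)
  exact h1.inter (hmap (measurableSet_forall_abs_le J))

/-- Two different observations close to the cut-off almost surely have different absolute values. -/
lemma measure_abs_eq_abs {P : Measure ℝ} [IsProbabilityMeasure P] {r : ℝ}
    (hP : ∀ x ∈ Set.Ioo (-r) r, P {x} = 0) {n : ℕ} {i j : Fin n} (hij : i ≠ j) :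
    Measure.pi (fun _ : Fin n => P) {z | z i ∈ Set.Ioo (-r) r ∧ |z j| = |z i|} = 0 := by
  have habs : Measurable fun x : ℝ => |x| := measurable_abs
  have hind : iIndepFun (fun (k : Fin n) (z : Fin n → ℝ) => z k) (Measure.pi fun _ => P) :=
    iIndepFun_pi (X := fun _ x => x) fun _ => aemeasurable_id
  have hpair := (hind.indepFun hij)
  have hmi : (Measure.pi fun _ : Fin n => P).map (fun z => z i) = P :=
    (measurePreserving_eval (fun _ : Fin n => P) i).map_eq
  have hmj : (Measure.pi fun _ : Fin n => P).map (fun z => z j) = P :=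
    (measurePreserving_eval (fun _ : Fin n => P) j).map_eq
  rw [indepFun_iff_map_prod_eq_prod_map_map (measurable_pi_apply i).aemeasurable
    (measurable_pi_apply j).aemeasurable, hmi, hmj] at hpair
  set T : Set (ℝ × ℝ) := {x | x.1 ∈ Set.Ioo (-r) r ∧ |x.2| = |x.1|} with hT
  have hTm : MeasurableSet T :=
    (measurable_fst measurableSet_Ioo).inter
      (measurableSet_eq_fun (habs.comp measurable_snd) (habs.comp measurable_fst))
  have h1 : Measure.pi (fun _ : Fin n => P) {z | z i ∈ Set.Ioo (-r) r ∧ |z j| = |z i|}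
      = (P.prod P) T := by
    rw [← hpair, Measure.map_apply ((measurable_pi_apply i).prodMk (measurable_pi_apply j)) hTm]
    rfl
  rw [h1, Measure.measure_prod_null hTm]
  refine Filter.Eventually.of_forall fun x => ?_
  by_cases hx : x ∈ Set.Ioo (-r) r
  · have hsub : Prod.mk x ⁻¹' T ⊆ {x} ∪ {-x} := by
      rintro y ⟨-, hy⟩
      exact abs_eq_abs.1 hy
    have hx' : -x ∈ Set.Ioo (-r) r := ⟨by linarith [hx.2], by linarith [hx.1]⟩
    exact measure_mono_null hsub (measure_union_null (hP x hx) (hP _ hx'))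
  · have : Prod.mk x ⁻¹' T = ∅ := by
      ext y
      simp only [hT, Set.mem_preimage, Set.mem_ofPred_eq, Set.mem_empty_iff_false, iff_false]
      exact fun h => hx h.1
    simp only [this]
    simp

/-- Two different sets of the same size each have an element missing from the other; if both are
nearest, these two observations tie in absolute value, a null event. -/
lemma sum_measure_nearestSet_le {P : Measure ℝ} [IsProbabilityMeasure P] {r : ℝ}
    (hP : ∀ x ∈ Set.Ioo (-r) r, P {x} = 0) (n q : ℕ) :
    ∑ J ∈ (Finset.univ : Finset (Fin n)).powersetCard q,
      Measure.pi (fun _ => P) (nearestSet r J) ≤ 1 := by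
  rw [← measure_biUnion_finset₀]
  · exact prob_le_one
  · intro J hJ J' hJ' hne
    simp only [Finset.mem_coe,
      Finset.mem_powersetCard] at hJ hJ'
    have hsub : nearestSet r J ∩ nearestSet r J' ⊆
        ⋃ i : Fin n, ⋃ j : Fin n, ⋃ _ : i ≠ j,
          {z : Fin n → ℝ | z i ∈ Set.Ioo (-r) r ∧ |z j| = |z i|} := by
      rintro z ⟨⟨h1, h2⟩, h3, h4⟩
      obtain ⟨i, hi, hi'⟩ : ∃ i ∈ J, i ∉ J' := Finset.not_subset.1 fun h =>
        hne (Finset.eq_of_subset_of_card_le h (by omega))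
      obtain ⟨j, hj, hj'⟩ : ∃ j ∈ J', j ∉ J := Finset.not_subset.1 fun h =>
        hne (Finset.eq_of_subset_of_card_le h (by omega)).symm
      simp only [Set.mem_iUnion]
      refine ⟨i, j, fun h => hj' (h ▸ hi), h1 i hi, ?_⟩
      exact le_antisymm (h4 j hj i hi') (h2 i hi j hj')
    refine measure_mono_null hsub ?_
    refine measure_iUnion_null fun i => measure_iUnion_null fun j => measure_iUnion_null fun h => ?_
    exact measure_abs_eq_abs hP h
  · exact fun J _ => (measurableSet_nearestSet r J).nullMeasurableSet

/-- The union of the events `nearestSignSet r J K` with `q` nearest observations, `s` of which are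
nonnegative. -/
def nearestCountSet (r : ℝ) (n q s : ℕ) : Set (Fin n → ℝ) :=
  ⋃ J ∈ (Finset.univ : Finset (Fin n)).powersetCard q, ⋃ K ∈ J.powersetCard s,
    nearestSignSet r J K

lemma measure_nearestCountSet_le {P : Measure ℝ} [IsProbabilityMeasure P] {r : ℝ} {c d : ℝ≥0}
    (hP : ∀ x ∈ Set.Ioo (-r) r, P {x} = 0)
    (hc : (P.restrict (Set.Ico 0 r)).map (fun x : ℝ => |x|)
      ≤ c • (P.restrict (Set.Ioo (-r) r)).map fun x : ℝ => |x|)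
    (hd : (P.restrict (Set.Ioo (-r) 0)).map (fun x : ℝ => |x|)
      ≤ d • (P.restrict (Set.Ioo (-r) r)).map fun x : ℝ => |x|) (n q s : ℕ) :
    Measure.pi (fun _ => P) (nearestCountSet r n q s)
      ≤ q.choose s * (c : ℝ≥0∞) ^ s * (d : ℝ≥0∞) ^ (q - s) := by
  calc Measure.pi (fun _ => P) (nearestCountSet r n q s)
      ≤ ∑ J ∈ (Finset.univ : Finset (Fin n)).powersetCard q, ∑ K ∈ J.powersetCard s,
          Measure.pi (fun _ => P) (nearestSignSet r J K) :=
        (measure_biUnion_finset_le _ _).trans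
          (Finset.sum_le_sum fun J _ => measure_biUnion_finset_le _ _)
    _ ≤ ∑ J ∈ (Finset.univ : Finset (Fin n)).powersetCard q, ∑ K ∈ J.powersetCard s,
          (c : ℝ≥0∞) ^ s * (d : ℝ≥0∞) ^ (q - s) * Measure.pi (fun _ => P) (nearestSet r J) := by
        refine Finset.sum_le_sum fun J hJ => Finset.sum_le_sum fun K hK => ?_
        rw [Finset.mem_powersetCard] at hJ hK
        have := measure_nearestSignSet_le hc hd hK.1
        rwa [hJ.2, hK.2] at this
    _ = q.choose s * (c : ℝ≥0∞) ^ s * (d : ℝ≥0∞) ^ (q - s)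
          * ∑ J ∈ (Finset.univ : Finset (Fin n)).powersetCard q,
            Measure.pi (fun _ => P) (nearestSet r J) := by
        rw [Finset.mul_sum]
        refine Finset.sum_congr rfl fun J hJ => ?_
        rw [Finset.mem_powersetCard] at hJ
        rw [Finset.sum_const, Finset.card_powersetCard, hJ.2, nsmul_eq_mul]
        ring
    _ ≤ _ := mul_le_of_le_one_right' (sum_measure_nearestSet_le hP n q)

lemma mem_nearestCountSet {r : ℝ} {n q : ℕ} {z : Fin n → ℝ} {σ : Equiv.Perm (Fin n)}
    (hσ : IsGOrdering (fun x => |x|) z σ)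
    (hcount : q ≤ (Finset.univ.filter fun i => z i ∈ Set.Ioo (-r) r).card) :
    z ∈ nearestCountSet r n q (signCount q z σ) := by
  have hqn : q ≤ n := hcount.trans ((Finset.card_le_univ _).trans (Fintype.card_fin n).le)
  set J : Finset (Fin n) := (Finset.univ.filter fun j : Fin n => j.val < q).map σ.toEmbedding
    with hJdef
  set K : Finset (Fin n) := J.filter fun i => 0 ≤ z i with hKdef
  have hmem : ∀ i, i ∈ J ↔ (σ.symm i).val < q := by
    intro i
    simp only [hJdef, Finset.mem_map_equiv, Finset.mem_filter, Finset.mem_univ, true_and]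
  have hlt : (Finset.univ.filter fun j : Fin n => j.val < q).card = q := by
    rw [Fin.card_filter_val_lt, min_eq_right hqn]
  have hJ : J.card = q := by rw [hJdef, Finset.card_map, hlt]
  have hK : K.card = signCount q z σ := by
    rw [signCount, hKdef, hJdef, Finset.filter_map, Finset.card_map, Finset.card_filter,
      Finset.sum_congr rfl fun _ _ => rfl]
    rfl
  simp only [nearestCountSet, Set.mem_iUnion, Finset.mem_powersetCard]
  refine ⟨J, ⟨Finset.subset_univ _, hJ⟩, K, ⟨Finset.filter_subset _ _, hK⟩, ⟨?_, ?_⟩, ?_⟩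
  · intro i hi
    by_contra hni
    -- If one of the first q lay outside (-r, r), all observations inside would strictly precede it,
    -- making them fewer than q.
    have hsub : (Finset.univ.filter fun i => z i ∈ Set.Ioo (-r) r)
        ⊆ (Finset.univ.filter fun j : Fin n => j < σ.symm i).map σ.toEmbedding := by
      intro k hk
      simp only [Finset.mem_map_equiv, Finset.mem_filter, Finset.mem_univ, true_and] at hk ⊢
      by_contra hle
      have h1 := hσ (not_lt.1 hle)
      simp only [Equiv.apply_symm_apply] at h1
      exact hni (abs_lt.1 (h1.trans_lt (abs_lt.2 hk)))
    have h1 := Finset.card_le_card hsub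
    rw [Finset.card_map] at h1
    have h2 : (Finset.univ.filter fun j : Fin n => j < σ.symm i).card = (σ.symm i).val := by
      rw [Finset.filter_gt_eq_Iio, Fin.card_Iio]
    have h3 := (hmem i).1 hi
    omega
  · intro i hi j hj
    rw [hmem] at hi hj
    have h1 := hσ (show σ.symm i ≤ σ.symm j from Fin.le_def.2 (by omega))
    simpa only [Equiv.apply_symm_apply] using h1
  · intro i hi
    simp [hKdef, hi]

/-! ### Consequences of the local density assumption -/

section LocalDensity

variable {P : Measure ℝ} {δ : ℝ} {f : ℝ → ℝ} {fplus fminus : ℝ}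

lemma HasDensityOn.measure_singleton {s : Set ℝ} (h : HasDensityOn P f s) {x : ℝ} (hx : x ∈ s) :
    P {x} = 0 := by
  rw [h.measure_eq {x} (measurableSet_singleton x) (Set.singleton_subset_iff.2 hx)]
  exact setLIntegral_measure_zero _ _ (by simp)

lemma HasDensityOn.measure_neg_preimage {s : Set ℝ} (h : HasDensityOn P f s) {B : Set ℝ}
    (hB : MeasurableSet B) (hBs : Neg.neg ⁻¹' B ⊆ s) :
    P (Neg.neg ⁻¹' B) = ∫⁻ x in B, ENNReal.ofReal (f (-x)) := by
  rw [h.measure_eq _ (measurable_neg hB) hBs,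
    ← (Measure.measurePreserving_neg (volume : Measure ℝ)).setLIntegral_comp_preimage_emb
      (Homeomorph.neg ℝ).measurableEmbedding (fun x => ENNReal.ofReal (f (-x))) B]
  simp only [neg_neg]

/-- For B in the positive half-line this identifies f(x) + f(-x) as the density of |Z|. -/
lemma HasDensityOn.lintegral_add_neg {s : Set ℝ} (h : HasDensityOn P f s) {B : Set ℝ}
    (hB : MeasurableSet B) (hBs : B ⊆ s) (hBs' : Neg.neg ⁻¹' B ⊆ s) :
    ∫⁻ x in B, ENNReal.ofReal (f x + f (-x)) = P B + P (Neg.neg ⁻¹' B) := by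
  have h1 : ∫⁻ x in B, ENNReal.ofReal (f x + f (-x))
      = ∫⁻ x in B, (ENNReal.ofReal (f x) + ENNReal.ofReal (f (-x))) := by
    refine setLIntegral_congr_fun hB fun x hx => ?_
    exact ENNReal.ofReal_add (h.nonneg x (hBs hx)) (h.nonneg _ (hBs' (by simpa using hx)))
  rw [h1, lintegral_add_left' ((h.aemeasurable.mono_set hBs).ennreal_ofReal),
    h.measure_eq B hB hBs, h.measure_neg_preimage hB hBs']

namespace LocalDensity

lemma fplus_nonneg (h : LocalDensity P δ f fplus fminus) : 0 ≤ fplus := by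
  refine ge_of_tendsto h.right_limit ?_
  filter_upwards [Ioo_mem_nhdsGT h.delta_pos] with x hx
  exact h.density.nonneg x ⟨by linarith [hx.1, h.delta_pos], hx.2⟩

lemma fminus_nonneg (h : LocalDensity P δ f fplus fminus) : 0 ≤ fminus := by
  refine ge_of_tendsto h.left_limit ?_
  filter_upwards [Ioo_mem_nhdsLT (neg_lt_zero.2 h.delta_pos)] with x hx
  exact h.density.nonneg x ⟨hx.1, by linarith [hx.2, h.delta_pos]⟩

/-- The first bound gives (-r, r) positive mass; the other two control the conditional sign
probabilities given |Z| = x. -/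
lemma exists_radius (h : LocalDensity P δ f fplus fminus) {η : ℝ} (hη : 0 < η) :
    ∃ r, 0 < r ∧ r ≤ δ ∧ ∀ x ∈ Set.Ioo 0 r,
      (fminus + fplus) / 2 ≤ f x + f (-x) ∧
      f x ≤ (fplus / (fminus + fplus) + η) * (f x + f (-x)) ∧
      f (-x) ≤ (1 - fplus / (fminus + fplus) + η) * (f x + f (-x)) := by
  have hs := h.sum_pos
  have hneg : Tendsto (fun x => f (-x)) (𝓝[>] 0) (𝓝 fminus) := by
    refine h.left_limit.comp ?_
    have := tendsto_neg_nhdsGT (a := (0 : ℝ))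
    rwa [neg_zero] at this
  have hsum : Tendsto (fun x => f x + f (-x)) (𝓝[>] 0) (𝓝 (fminus + fplus)) := by
    rw [add_comm fminus]
    exact h.right_limit.add hneg
  have h1 : ∀ᶠ x in 𝓝[>] 0, (fminus + fplus) / 2 < f x + f (-x) :=
    hsum.eventually_const_lt (by linarith)
  have h2 : ∀ᶠ x in 𝓝[>] 0, f x < (fplus / (fminus + fplus) + η) * (f x + f (-x)) := by
    refine h.right_limit.eventually_lt (hsum.const_mul _) ?_
    have : (fplus / (fminus + fplus) + η) * (fminus + fplus)
        = fplus + η * (fminus + fplus) := by field_simp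
    rw [this]
    have := mul_pos hη hs
    linarith
  have h3 : ∀ᶠ x in 𝓝[>] 0, f (-x) < (1 - fplus / (fminus + fplus) + η) * (f x + f (-x)) := by
    refine hneg.eventually_lt (hsum.const_mul _) ?_
    have : (1 - fplus / (fminus + fplus) + η) * (fminus + fplus)
        = fminus + η * (fminus + fplus) := by field_simp; ring
    rw [this]
    have := mul_pos hη hs
    linarith
  obtain ⟨r, hr, hsub⟩ := (mem_nhdsGT_iff_exists_Ioo_subset).1 (h1.and (h2.and h3))
  refine ⟨min r δ, lt_min hr h.delta_pos, min_le_right _ _, fun x hx => ?_⟩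
  obtain ⟨a1, a2, a3⟩ := hsub ⟨hx.1, hx.2.trans_le (min_le_left _ _)⟩
  exact ⟨a1.le, a2.le, a3.le⟩

variable {r : ℝ}

lemma Ioo_subset (hr : r ≤ δ) : Set.Ioo (-r) r ⊆ Set.Ioo (-δ) δ :=
  Set.Ioo_subset_Ioo (by linarith) hr

lemma measure_Ioo_pos (h : LocalDensity P δ f fplus fminus) (hr0 : 0 < r) (hr : r ≤ δ)
    (hf : ∀ x ∈ Set.Ioo 0 r, (fminus + fplus) / 2 ≤ f x + f (-x)) : P (Set.Ioo (-r) r) ≠ 0 := by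
  intro h0
  have hB : Set.Ioo 0 r ⊆ Set.Ioo (-r) r := Set.Ioo_subset_Ioo (by linarith) le_rfl
  have hB' : Neg.neg ⁻¹' Set.Ioo 0 r ⊆ Set.Ioo (-r) r := fun x hx => by
    obtain ⟨h1, h2⟩ := hx
    exact ⟨by linarith, by linarith⟩
  have h1 := h.density.lintegral_add_neg measurableSet_Ioo (hB.trans (Ioo_subset hr))
    (hB'.trans (Ioo_subset hr))
  rw [measure_mono_null hB h0, measure_mono_null hB' h0, add_zero] at h1
  have h2 : ∫⁻ _ in Set.Ioo 0 r, ENNReal.ofReal ((fminus + fplus) / 2)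
      ≤ ∫⁻ x in Set.Ioo 0 r, ENNReal.ofReal (f x + f (-x)) :=
    setLIntegral_mono' measurableSet_Ioo fun x hx => ENNReal.ofReal_le_ofReal (hf x hx)
  rw [h1, setLIntegral_const, Real.volume_Ioo, sub_zero, nonpos_iff_eq_zero, mul_eq_zero,
    ENNReal.ofReal_eq_zero, ENNReal.ofReal_eq_zero] at h2
  have := h.sum_pos
  rcases h2 with h2 | h2 <;> linarith

lemma measure_add_measure_neg_le {A : Set ℝ} (hA : MeasurableSet A) :
    P ((fun x : ℝ => |x|) ⁻¹' A ∩ Set.Ioo 0 r)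
        + P (Neg.neg ⁻¹' ((fun x : ℝ => |x|) ⁻¹' A ∩ Set.Ioo 0 r))
      ≤ (P.restrict (Set.Ioo (-r) r)).map (fun x : ℝ => |x|) A := by
  have hB : MeasurableSet ((fun x : ℝ => |x|) ⁻¹' A ∩ Set.Ioo 0 r) :=
    (measurable_abs hA).inter measurableSet_Ioo
  rw [← measure_union _ (measurable_neg hB), Measure.map_apply measurable_abs hA,
    Measure.restrict_apply (measurable_abs hA)]
  · refine measure_mono ?_
    rintro x (⟨h1, h2, h3⟩ | ⟨h1, h2, h3⟩)
    · exact ⟨h1, by linarith, h3⟩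
    · refine ⟨?_, by linarith, by linarith⟩
      simpa only [Set.mem_preimage, abs_neg] using h1
  · rw [Set.disjoint_left]
    rintro x ⟨-, h1, -⟩ ⟨-, h2, -⟩
    linarith

lemma map_abs_restrict_nonneg_le (h : LocalDensity P δ f fplus fminus) (hr0 : 0 < r) (hr : r ≤ δ)
    {c : ℝ} (hf : ∀ x ∈ Set.Ioo 0 r, f x ≤ c * (f x + f (-x))) (hc : 0 ≤ c) :
    (P.restrict (Set.Ico 0 r)).map (fun x : ℝ => |x|)
      ≤ c.toNNReal • (P.restrict (Set.Ioo (-r) r)).map fun x : ℝ => |x| := by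
  refine Measure.le_iff.2 fun A hA => ?_
  set B := (fun x : ℝ => |x|) ⁻¹' A ∩ Set.Ioo 0 r with hBdef
  have hB : MeasurableSet B := (measurable_abs hA).inter measurableSet_Ioo
  have hBs : B ⊆ Set.Ioo (-δ) δ := fun x hx =>
    ⟨by linarith [hx.2.1, h.delta_pos], hx.2.2.trans_le hr⟩
  have hBs' : Neg.neg ⁻¹' B ⊆ Set.Ioo (-δ) δ := fun x hx => by
    obtain ⟨-, h1, h2⟩ := hx
    exact ⟨by linarith, by linarith [h.delta_pos]⟩
  have h1 : (P.restrict (Set.Ico 0 r)).map (fun x : ℝ => |x|) A ≤ P B := by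
    rw [Measure.map_apply measurable_abs hA, Measure.restrict_apply (measurable_abs hA)]
    -- The point 0 counts as nonnegative but is not covered by the density bounds; it carries no
    -- mass.
    have hsub : (fun x : ℝ => |x|) ⁻¹' A ∩ Set.Ico 0 r ⊆ B ∪ {0} := by
      rintro x ⟨hx1, hx2, hx3⟩
      rcases hx2.eq_or_lt with h0 | h0
      · exact Or.inr h0.symm
      · exact Or.inl ⟨hx1, h0, hx3⟩
    refine (measure_mono hsub).trans ((measure_union_le _ _).trans ?_)
    rw [h.density.measure_singleton ⟨neg_lt_zero.2 h.delta_pos, h.delta_pos⟩, add_zero]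
  have h2 : P B ≤ ENNReal.ofReal c * (P B + P (Neg.neg ⁻¹' B)) := by
    rw [← h.density.lintegral_add_neg hB hBs hBs', h.density.measure_eq B hB hBs,
      ← lintegral_const_mul' _ _ ENNReal.ofReal_ne_top]
    refine setLIntegral_mono' hB fun x hx => ?_
    rw [← ENNReal.ofReal_mul hc]
    exact ENNReal.ofReal_le_ofReal (hf x hx.2)
  refine h1.trans (h2.trans ?_)
  exact mul_le_mul_right (measure_add_measure_neg_le hA) _

lemma map_abs_restrict_neg_le (h : LocalDensity P δ f fplus fminus) (hr0 : 0 < r) (hr : r ≤ δ)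
    {c : ℝ} (hf : ∀ x ∈ Set.Ioo 0 r, f (-x) ≤ c * (f x + f (-x))) (hc : 0 ≤ c) :
    (P.restrict (Set.Ioo (-r) 0)).map (fun x : ℝ => |x|)
      ≤ c.toNNReal • (P.restrict (Set.Ioo (-r) r)).map fun x : ℝ => |x| := by
  refine Measure.le_iff.2 fun A hA => ?_
  set B := (fun x : ℝ => |x|) ⁻¹' A ∩ Set.Ioo 0 r with hBdef
  have hB : MeasurableSet B := (measurable_abs hA).inter measurableSet_Ioo
  have hBs : B ⊆ Set.Ioo (-δ) δ := fun x hx =>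
    ⟨by linarith [hx.2.1, h.delta_pos], hx.2.2.trans_le hr⟩
  have hBs' : Neg.neg ⁻¹' B ⊆ Set.Ioo (-δ) δ := fun x hx => by
    obtain ⟨-, h1, h2⟩ := hx
    exact ⟨by linarith, by linarith [h.delta_pos]⟩
  have h1 : (P.restrict (Set.Ioo (-r) 0)).map (fun x : ℝ => |x|) A ≤ P (Neg.neg ⁻¹' B) := by
    rw [Measure.map_apply measurable_abs hA, Measure.restrict_apply (measurable_abs hA)]
    refine measure_mono ?_
    rintro x ⟨hx1, hx2, hx3⟩
    refine ⟨?_, by linarith, by linarith⟩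
    simpa only [Set.mem_preimage, abs_neg] using hx1
  have h2 : P (Neg.neg ⁻¹' B) ≤ ENNReal.ofReal c * (P B + P (Neg.neg ⁻¹' B)) := by
    rw [← h.density.lintegral_add_neg hB hBs hBs', h.density.measure_neg_preimage hB hBs',
      ← lintegral_const_mul' _ _ ENNReal.ofReal_ne_top]
    refine setLIntegral_mono' hB fun x hx => ?_
    rw [← ENNReal.ofReal_mul hc]
    exact ENNReal.ofReal_le_ofReal (hf x hx.2)
  refine h1.trans (h2.trans ?_)
  exact mul_le_mul_right (measure_add_measure_neg_le hA) _

end LocalDensity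

end LocalDensity

/-! ### The number of observations in a set of positive probability -/

section Sample

variable {Ω : Type*} [MeasurableSpace Ω] {μ : Measure Ω} [IsProbabilityMeasure μ] {P : Measure ℝ}
  {Z : ℕ → Ω → ℝ}

open Classical in
/-- The number of observations among the first `n` that lie in `I`. -/
noncomputable def hitCount (Z : ℕ → Ω → ℝ) (I : Set ℝ) (n : ℕ) (ω : Ω) : ℕ :=
  Nat.count (fun i => Z i ω ∈ I) n

omit [MeasurableSpace Ω] in
lemma monotone_hitCount (Z : ℕ → Ω → ℝ) (I : Set ℝ) (ω : Ω) :
    Monotone fun n => hitCount Z I n ω := by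
  classical
  exact Nat.count_monotone _

lemma measurable_hitCount (hZ : ∀ i, Measurable (Z i)) {I : Set ℝ} (hI : MeasurableSet I) (n : ℕ) :
    Measurable (hitCount Z I n) := by
  classical
  induction n with
  | zero =>
    have : hitCount Z I 0 = fun _ => 0 := funext fun _ => Nat.count_zero _
    rw [this]
    exact measurable_const
  | succ n ih =>
    have : hitCount Z I (n + 1) = fun ω => hitCount Z I n ω + if Z n ω ∈ I then 1 else 0 :=
      by
      funext ω
      rw [hitCount, hitCount, Nat.count_succ]
    rw [this]
    exact ih.add (Measurable.ite (hZ n hI) measurable_const measurable_const)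

omit [MeasurableSpace Ω] in
lemma hitCount_le_card (I : Set ℝ) (n : ℕ) (ω : Ω) [DecidablePred fun i : Fin n => Z i ω ∈ I] :
    hitCount Z I n ω ≤ (Finset.univ.filter fun i : Fin n => Z i ω ∈ I).card := by
  classical
  rw [hitCount, Nat.count_eq_card_filter_range, ← Finset.card_map Fin.valEmbedding]
  refine Finset.card_le_card fun i hi => ?_
  rw [Finset.mem_filter, Finset.mem_range] at hi
  rw [Finset.mem_map]
  exact ⟨⟨i, hi.1⟩, by simpa using hi.2, rfl⟩

/-- By the second Borel–Cantelli lemma, infinitely many observations hit `I` almost surely. -/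
lemma ae_exists_le_hitCount (hZ : ∀ i, Measurable (Z i)) (hind : iIndepFun Z μ)
    (hlaw : ∀ i, μ.map (Z i) = P) {I : Set ℝ} (hI : MeasurableSet I) (hPI : P I ≠ 0) (q : ℕ) :
    ∀ᵐ ω ∂μ, ∃ n, q ≤ hitCount Z I n ω := by
  have hm : ∀ i, MeasurableSet (Z i ⁻¹' I) := fun i => hZ i hI
  have hset : iIndepSet (fun i => Z i ⁻¹' I) μ := by
    rw [iIndepSet_iff_meas_biInter hm]
    exact fun s => hind.measure_inter_preimage_eq_mul s fun _ _ => hI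
  have hsum : ∑' i, μ (Z i ⁻¹' I) = ∞ := by
    have : ∀ i, μ (Z i ⁻¹' I) = P I := fun i => by
      rw [← hlaw i, Measure.map_apply (hZ i) hI]
    simp only [this]
    exact ENNReal.tsum_const_eq_top_of_ne_zero hPI
  have h1 := measure_limsup_eq_one hm hset hsum
  have h2 : ∀ᵐ ω ∂μ, ω ∈ limsup (fun i => Z i ⁻¹' I) atTop := by
    rw [← mem_ae_iff_prob_eq_one (MeasurableSet.measurableSet_limsup hm)] at h1
    exact h1
  filter_upwards [h2] with ω hω
  rw [mem_limsup_iff_frequently_mem, Nat.frequently_atTop_iff_infinite] at hω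
  classical
  obtain ⟨n, hn⟩ := Nat.surjective_count_of_infinite_setOfPred hω q
  refine ⟨n, ?_⟩
  rw [hitCount, ← hn]
  exact le_of_eq (by congr!)

lemma tendsto_measure_hitCount_lt (hZ : ∀ i, Measurable (Z i)) (hind : iIndepFun Z μ)
    (hlaw : ∀ i, μ.map (Z i) = P) {I : Set ℝ} (hI : MeasurableSet I) (hPI : P I ≠ 0) (q : ℕ) :
    Tendsto (fun n => μ {ω | hitCount Z I n ω < q}) atTop (𝓝 0) := by
  have hanti : Antitone fun n => {ω | hitCount Z I n ω < q} := fun m n hmn ω hω =>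
    lt_of_le_of_lt (monotone_hitCount Z I ω hmn) hω
  have h := tendsto_measure_iInter_atTop (μ := μ) (s := fun n => {ω | hitCount Z I n ω < q})
    (fun n => (measurable_hitCount hZ hI n measurableSet_Iio).nullMeasurableSet) hanti
    ⟨0, measure_ne_top _ _⟩
  have h0 : μ (⋂ n, {ω | hitCount Z I n ω < q}) = 0 := by
    rw [measure_eq_zero_iff_ae_notMem]
    filter_upwards [ae_exists_le_hitCount hZ hind hlaw hI hPI q] with ω ⟨n, hn⟩ hmem
    exact absurd (Set.mem_iInter.1 hmem n) (not_lt.2 hn)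
  rwa [h0] at h

/-! ### The limit distribution of the number of nonnegative nearest observations -/

variable {δ : ℝ} {f : ℝ → ℝ} {fplus fminus : ℝ} {q : ℕ}
  {σ : (n : ℕ) → Ω → Equiv.Perm (Fin n)}

lemma signCount_le (q : ℕ) {n : ℕ} (z : Fin n → ℝ) (τ : Equiv.Perm (Fin n)) :
    signCount q z τ ≤ q := by
  calc signCount q z τ ≤ ∑ j : Fin n with j.val < q, 1 :=
        Finset.sum_le_sum fun j _ => by split_ifs <;> simp
    _ = min n q := by rw [← Finset.card_eq_sum_ones, Fin.card_filter_val_lt]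
    _ ≤ q := min_le_right _ _

lemma measure_signCount_eq_le (hZ : ∀ i, Measurable (Z i)) (hind : iIndepFun Z μ)
    (hlaw : ∀ i, μ.map (Z i) = P)
    (hσ : ∀ n ω, IsGOrdering (fun z => |z|) (fun i : Fin n => Z i ω) (σ n ω)) (r : ℝ) (n s : ℕ) :
    μ {ω | signCount q (fun i : Fin n => Z i ω) (σ n ω) = s}
      ≤ μ {ω | hitCount Z (Set.Ioo (-r) r) n ω < q}
        + Measure.pi (fun _ => P) (nearestCountSet r n q s) := by
  have hmap : μ.map (fun ω (i : Fin n) => Z i ω) = Measure.pi fun _ => P := by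
    have h1 := (iIndepFun_iff_map_fun_eq_pi_map (fun i : Fin n => (hZ i).aemeasurable)).1
      (hind.precomp Fin.val_injective)
    rw [h1]
    simp only [hlaw]
  have hsub : {ω | signCount q (fun i : Fin n => Z i ω) (σ n ω) = s}
      ⊆ {ω | hitCount Z (Set.Ioo (-r) r) n ω < q}
        ∪ (fun ω (i : Fin n) => Z i ω) ⁻¹' nearestCountSet r n q s := by
    intro ω hω
    rcases lt_or_ge (hitCount Z (Set.Ioo (-r) r) n ω) q with h | h
    · exact Or.inl h
    · right
      have hs : signCount q (fun i : Fin n => Z i ω) (σ n ω) = s := hω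
      rw [← hs]
      exact mem_nearestCountSet (hσ n ω) (h.trans (hitCount_le_card _ n ω))
  refine (measure_mono hsub).trans ((measure_union_le _ _).trans ?_)
  gcongr
  rw [← hmap]
  -- This inequality holds for arbitrary sets, so `nearestCountSet` need not be shown measurable.
  exact Measure.le_map_apply
    (measurable_pi_lambda (fun ω (i : Fin n) => Z i ω) fun i => hZ i).aemeasurable _

lemma eventually_measure_signCount_eq_le (hZ : ∀ i, Measurable (Z i)) (hind : iIndepFun Z μ)
    (hlaw : ∀ i, μ.map (Z i) = P) (hP : LocalDensity P δ f fplus fminus)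
    (hσ : ∀ n ω, IsGOrdering (fun z => |z|) (fun i : Fin n => Z i ω) (σ n ω)) (s : ℕ)
    {ε : ℝ} (hε : 0 < ε) :
    ∀ᶠ n in atTop, μ.real {ω | signCount q (fun i : Fin n => Z i ω) (σ n ω) = s}
      ≤ binomialWeight q (fplus / (fminus + fplus)) s + ε := by
  have hPprob : IsProbabilityMeasure P := by
    rw [← hlaw 0]
    exact Measure.isProbabilityMeasure_map (hZ 0).aemeasurable
  set p := fplus / (fminus + fplus) with hp
  have hp0 : 0 ≤ p := div_nonneg hP.fplus_nonneg hP.sum_pos.le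
  have hp1 : p ≤ 1 := (div_le_one hP.sum_pos).2 (by linarith [hP.fminus_nonneg])
  -- Half of ε absorbs the perturbation of the sign probabilities; the other half pays for having
  -- fewer than q observations in (-r, r).
  obtain ⟨η, hη0, hη⟩ : ∃ η : ℝ, 0 < η ∧
      (q.choose s : ℝ) * (p + η) ^ s * (1 - p + η) ^ (q - s) < binomialWeight q p s + ε / 2 := by
    have hcont : Continuous fun η : ℝ =>
        (q.choose s : ℝ) * (p + η) ^ s * (1 - p + η) ^ (q - s) := by fun_prop
    have h0 := hcont.tendsto 0
    simp only [add_zero] at h0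
    have h1 : ∀ᶠ η in 𝓝 (0 : ℝ), (q.choose s : ℝ) * (p + η) ^ s * (1 - p + η) ^ (q - s)
        < binomialWeight q p s + ε / 2 :=
      h0.eventually_lt_const (by rw [binomialWeight]; linarith)
    have h2 : ∀ᶠ η in 𝓝[>] (0 : ℝ), 0 < η := eventually_mem_nhdsWithin
    exact (h2.and (h1.filter_mono nhdsWithin_le_nhds)).exists
  obtain ⟨r, hr0, hrδ, hr⟩ := hP.exists_radius hη0
  have hc := hP.map_abs_restrict_nonneg_le hr0 hrδ (fun x hx => (hr x hx).2.1) (by positivity)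
  have hd := hP.map_abs_restrict_neg_le hr0 hrδ (fun x hx => (hr x hx).2.2) (by linarith)
  have hpos := hP.measure_Ioo_pos hr0 hrδ fun x hx => (hr x hx).1
  have hatom : ∀ x ∈ Set.Ioo (-r) r, P {x} = 0 := fun x hx =>
    hP.density.measure_singleton (LocalDensity.Ioo_subset hrδ hx)
  have hlim := tendsto_measure_hitCount_lt hZ hind hlaw measurableSet_Ioo hpos q
  filter_upwards [hlim.eventually_lt_const (ENNReal.ofReal_pos.2 (half_pos hε))] with n hn
  have h1 := (measure_signCount_eq_le (q := q) hZ hind hlaw hσ r n s).trans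
    (add_le_add hn.le (measure_nearestCountSet_le hatom hc hd n q s))
  have h2 : (q.choose s : ℝ≥0∞) * ((p + η).toNNReal : ℝ≥0∞) ^ s
      * ((1 - p + η).toNNReal : ℝ≥0∞) ^ (q - s)
      = ENNReal.ofReal ((q.choose s : ℝ) * (p + η) ^ s * (1 - p + η) ^ (q - s)) := by
    rw [ENNReal.ofReal_mul (by positivity), ENNReal.ofReal_mul (by positivity),
      ENNReal.ofReal_pow (by positivity), ENNReal.ofReal_pow (by linarith), ENNReal.ofReal_natCast]
    rfl
  rw [h2, ← ENNReal.ofReal_add (by positivity)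
    (mul_nonneg (by positivity) (pow_nonneg (by linarith) _))] at h1
  refine (ENNReal.toReal_le_of_le_ofReal (add_nonneg (by positivity)
    (mul_nonneg (by positivity) (pow_nonneg (by linarith) _))) h1).trans ?_
  linarith

lemma integral_comp_signCount (hS : ∀ n, Measurable fun ω =>
      signCount q (fun i : Fin n => Z i ω) (σ n ω)) (g : ℕ → ℝ) (n : ℕ) :
    ∫ ω, g (signCount q (fun i : Fin n => Z i ω) (σ n ω)) ∂μ
      = ∑ s ∈ Finset.range (q + 1),
        g s * μ.real {ω | signCount q (fun i : Fin n => Z i ω) (σ n ω) = s} := by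
  have hm : ∀ s, MeasurableSet {ω | signCount q (fun i : Fin n => Z i ω) (σ n ω) = s} :=
    fun s => hS n (measurableSet_singleton s)
  have h1 : ∀ ω, g (signCount q (fun i : Fin n => Z i ω) (σ n ω))
      = ∑ s ∈ Finset.range (q + 1), g s *
        ({ω | signCount q (fun i : Fin n => Z i ω) (σ n ω) = s}.indicator 1 ω : ℝ) := by
    intro ω
    have hle := signCount_le q (fun i : Fin n => Z i ω) (σ n ω)
    rw [Finset.sum_eq_single (signCount q (fun i : Fin n => Z i ω) (σ n ω))]
    · simp
    · intro s _ hs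
      simp [hs.symm]
    · intro h
      exact absurd (Finset.mem_range.2 (Nat.lt_succ_of_le hle)) h
  simp only [h1]
  rw [integral_finsetSum]
  · refine Finset.sum_congr rfl fun s _ => ?_
    rw [integral_const_mul, integral_indicator_one (hm s)]
  · intro s _
    exact ((integrable_const (1 : ℝ)).indicator (hm s)).const_mul _

/-- `S_n` is asymptotically `Bi(q, p)`-distributed with `p = fplus / (fminus + fplus)`. -/
lemma tendsto_integral_comp_signCount (hZ : ∀ i, Measurable (Z i)) (hind : iIndepFun Z μ)
    (hlaw : ∀ i, μ.map (Z i) = P) (hP : LocalDensity P δ f fplus fminus)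
    (hσ : ∀ n ω, IsGOrdering (fun z => |z|) (fun i : Fin n => Z i ω) (σ n ω))
    (hS : ∀ n, Measurable fun ω => signCount q (fun i : Fin n => Z i ω) (σ n ω)) (g : ℕ → ℝ) :
    Tendsto (fun n : ℕ => ∫ ω, g (signCount q (fun i : Fin n => Z i ω) (σ n ω)) ∂μ) atTop
      (𝓝 (∑ s ∈ Finset.range (q + 1), g s * binomialWeight q (fplus / (fminus + fplus)) s)) := by
  simp only [integral_comp_signCount hS g]
  refine tendsto_finsetSum _ fun s hs => Tendsto.const_mul _ ?_
  refine tendsto_of_forall_le_add (I := Finset.range (q + 1))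
    (a := fun n s => μ.real {ω | signCount q (fun i : Fin n => Z i ω) (σ n ω) = s})
    (fun n => ?_) (sum_binomialWeight q _)
    (fun s _ ε hε => eventually_measure_signCount_eq_le hZ hind hlaw hP hσ s hε) hs
  -- The constant test function yields total mass 1.
  have h := integral_comp_signCount (μ := μ) hS (fun _ => 1) n
  simpa using h.symm

end Sample

end SignTest

theorem theorem4p2 {Ω : Type*} [MeasurableSpace Ω] (μ : Measure Ω) [IsProbabilityMeasure μ]
    -- `Z 0, Z 1, …` are i.i.d. with distribution `P`
    (P : Measure ℝ) (Z : ℕ → Ω → ℝ)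
    (hZ_meas : ∀ i, Measurable (Z i)) (hZ_indep : iIndepFun Z μ) (hZ_law : ∀ i, μ.map (Z i) = P)
    -- local assumptions on `P` at the cut-off `0`
    (δ : ℝ) (f : ℝ → ℝ) (fplus fminus : ℝ) (hP : SignTest.LocalDensity P δ f fplus fminus)
    (q : ℕ) (hq : 1 ≤ q) (α : ℝ) (hα0 : 0 < α) (hα1 : α < 1)
    -- for even `q`, levels above `P(Bi(q, 1/2) ≠ q / 2)` are excluded
    (hαq : Even q → α ≤ 1 - (q.choose (q / 2) : ℝ) / 2 ^ q)
    -- for each `n`, an ordering of `Z 0, …, Z (n - 1)` by absolute value, with ties broken in any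
    -- way (possibly at random) for which `S_n` is a random variable
    (σ : (n : ℕ) → Ω → Equiv.Perm (Fin n))
    (hσ : ∀ n ω, SignTest.IsGOrdering (fun z => |z|) (fun i : Fin n => Z i ω) (σ n ω))
    (hS_meas : ∀ n, Measurable fun ω =>
      SignTest.signCount q (fun i : Fin n => Z i ω) (σ n ω)) :
    -- under `H₀`
    (fplus = fminus →
      Tendsto
          (fun n : ℕ => ∫ ω, SignTest.phi q α
            (SignTest.signCount q (fun i : Fin n => Z i ω) (σ n ω)) ∂μ)
          atTop
          (𝓝 (2 * SignTest.Psi q ((SignTest.bq q α : ℝ) - 1)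
            + SignTest.aq q α / 2 ^ (q - 1) * (q.choose (SignTest.bq q α) : ℝ))) ∧
        2 * SignTest.Psi q ((SignTest.bq q α : ℝ) - 1)
            + SignTest.aq q α / 2 ^ (q - 1) * (q.choose (SignTest.bq q α) : ℝ) = α) ∧
    -- under `H₁`
    (fplus ≠ fminus →
      ∃ L : ℝ, Tendsto
          (fun n : ℕ => ∫ ω, SignTest.phi q α
            (SignTest.signCount q (fun i : Fin n => Z i ω) (σ n ω)) ∂μ)
          atTop (𝓝 L) ∧
        α ≤ L) := by
  have hlim := SignTest.tendsto_integral_comp_signCount hZ_meas hZ_indep hZ_law hP hσ hS_meas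
    (SignTest.phi q α)
  have hlevel := SignTest.two_mul_Psi_add (q := q) (α := α)
    ((SignTest.isCriticalCount_bq q hα0 hα1).1.trans (Nat.div_le_self q 2))
  refine ⟨fun h => ⟨?_, hlevel⟩, fun _ => ⟨_, hlim, ?_⟩⟩
  · have hp : fplus / (fminus + fplus) = 1 / 2 := by
      have := hP.sum_pos
      rw [div_eq_div_iff this.ne' two_ne_zero, h]
      ring
    rw [hlevel]
    rwa [hp, SignTest.sum_phi_mul_binomialWeight_half hq hα0 hα1 hαq] at hlim
  · exact SignTest.le_sum_phi_mul_binomialWeight hq hα0 hα1 hαq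
      (div_nonneg hP.fplus_nonneg hP.sum_pos.le)
      ((div_le_one hP.sum_pos).2 (by linarith [hP.fminus_nonneg]))
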